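/- Let $G$ be a group acting by diffeomorphisms on a smooth $n$-dimensional manifold $M$. Let $\Omega^q(M)$ be the smooth $q$-forms ($q\ge 0$), a right $G$-module by pull back, $\Omega^q(M)^G$ the invariant forms, and $H^q(M)$ the (de Rham) real cohomology with the induced right $G$-action. For a right $G$-module $A$ let $C^p(G,A)$ be the maps $G^p\to A$, with $$(Df)(g_1,\dots,g_{p+1})=f(g_2,\dots,g_{p+1})+\sum_{i=1}^p(-1)^if(g_1,\dots,g_ig_{i+1},\dots,g_{p+1})+(-1)^{p+1}f(g_1,\dots,g_p)g_{p+1},$$ and let $H^p(G,A)$ be the cohomology of $(C^*(G,A),D)$. On $C^p(G,\Omega^q(M))$ let $\delta'=D$, $(\delta''c)(g_1,\dots,g_p)=(-1)^p\,d(c(g_1,\dots,g_p))$ and $\delta=\delta'+\delta''$. Let $H^*(G,M,\Omega(M))$ be the cohomology of the total complex $\bigoplus_{p,q}C^p(G,\Omega^q(M))$ with differential $\delta$, let $F_r=\bigoplus_{p\ge r,\,q}C^p(G,\Omega^q(M))$, and let $h_r:H^*(F_r)\to H^*(G,M,\Omega(M))$ be induced by inclusion. For a closed $\omega\in\Omega^m(M)^G\subset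 C^0(G,\Omega^m(M))$ let $h(\omega)$ be its class in $H^m(G,M,\Omega(M))$. A zig-zag for $\omega$ is a sequence $\varphi_{i,m-i-1}\in C^i(G,\Omega^{m-i-1}(M))$, $0\le i\le p$, with $\omega=-d\varphi_{0,m-1}$ and $\delta'\varphi_{i-1,m-i}+\delta''\varphi_{i,m-i-1}=0$ for $1\le i\le p$. A cochain $z\in C^k(G,\Omega^q(M))$ is said to represent $c\in H^k(G,H^q(M))$ if its values are closed forms and their cohomology classes form a cocycle in $C^k(G,H^q(M))$ of class $c$. **Theorem.** Let $\omega\in\Omega^m(M)^G$ be exact on $M$, and suppose that $H^{m-p}(M)=\dots=H^{m-1}(M)=0$ and $H^{m-p-1}(M)\neq 0$ for some $1\le p\le m-1$. Then $h(\omega)\in\operatorname{Im}h_{p+1}$, zig-zags for $\omega$ exist, and there is a unique class $c(\omega)\in H^{p+1}(G,H^{m-p-1}(M))$ such that: 1. for every $\delta$-cocycle $z\in F_{p+1}$ of total degree $m$ with $h_{p+1}([z])=h(\omega)$, the component of $z$ in $C^{p+1}(G,\Omega^{m-p-1}(M))$ represents $c(\omega)$ (so $c(\omega)$ is determined by $h(\omega)$);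 2. for every $\omega'\in\Omega^m(M)^G$ with $\omega-\omega'\in d(\Omega^{m-1}(M)^G)$ and every zig-zag $(\varphi_{i,m-i-1})$ for $\omega'$, the cochain $\delta'\varphi_{p,m-p-1}$ represents $c(\omega)$ (so $c(\omega)$ depends neither on the zig-zag nor on the choice of $\omega$ in its cohomology class in $\Omega(M)^G$). -/

import Mathlib

open scoped Manifold ContDiff

noncomputable section
namespace EquivariantForms

/-- The model space `ℝⁿ`. -/
abbrev Model (n : ℕ) : Type := EuclideanSpace ℝ (Fin n)

/-- Alternating `q`-linear forms on `ℝⁿ`. A differential `q`-form on an `n`-manifold `M` is a map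
`M → AltForm n q`, since Mathlib's tangent space `TangentSpace (𝓡 n) x` is by definition the model
space `ℝⁿ` (through the preferred chart at `x`). -/
abbrev AltForm (n q : ℕ) : Type := Model n [⋀^Fin q]→L[ℝ] ℝ

section Raw
variable {n : ℕ} {M N P : Type*}
  [TopologicalSpace M] [ChartedSpace (Model n) M]
  [TopologicalSpace N] [ChartedSpace (Model n) N]
  [TopologicalSpace P] [ChartedSpace (Model n) P]

/-- The differential `T_x f : T_x M → T_{f x} N`. -/
def tangentMapAt (f : M → N) (x : M) : Model n →L[ℝ] Model n :=
  mfderiv (𝓡 n) (𝓡 n) f x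

/-- The pull back `f^* α`. -/
def rawPullback {q : ℕ} (f : M → N) (α : N → AltForm n q) (x : M) : AltForm n q :=
  (α (f x)).compContinuousLinearMap (tangentMapAt f x)

/-- The expression of a form in the chart around `x` (meaningful on the target of the chart). -/
def chartRep {q : ℕ} (α : M → AltForm n q) (x : M) : Model n → AltForm n q :=
  rawPullback (chartAt (Model n) x).symm α

/-- A form is smooth if its expressions in the charts are smooth. -/
def IsSmoothForm {q : ℕ} (α : M → AltForm n q) : Prop :=
  ∀ x : M, ContDiffOn ℝ ∞ (chartRep α x) (chartAt (Model n) x).target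

/-- The exterior derivative, computed at `x` in the chart around `x`; by `chartRep_rawD` below any
other preferred chart gives the same result. -/
def rawD {q : ℕ} (α : M → AltForm n q) (x : M) : AltForm n (q + 1) :=
  (extDeriv (chartRep α x) (chartAt (Model n) x x)).compContinuousLinearMap
    (tangentMapAt (chartAt (Model n) x) x)

theorem tangentMapAt_comp {f : M → N} {g : N → P} {x : M}
    (hg : MDifferentiableAt (𝓡 n) (𝓡 n) g (f x)) (hf : MDifferentiableAt (𝓡 n) (𝓡 n) f x) :
    tangentMapAt (n := n) (g ∘ f) x = (tangentMapAt g (f x)).comp (tangentMapAt f x) :=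
  mfderiv_comp x hg hf

theorem tangentMapAt_id (x : M) :
    tangentMapAt (n := n) (id : M → M) x = ContinuousLinearMap.id ℝ (Model n) :=
  mfderiv_id

theorem tangentMapAt_congr {f g : M → N} {x : M} (h : f =ᶠ[nhds x] g) :
    tangentMapAt (n := n) f x = tangentMapAt g x :=
  Filter.EventuallyEq.mfderiv_eq h

theorem tangentMapAt_eq_fderiv (f : Model n → Model n) (y : Model n) :
    tangentMapAt (n := n) f y = fderiv ℝ f y :=
  mfderiv_eq_fderiv

theorem rawPullback_id {q : ℕ} (α : M → AltForm n q) :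
    rawPullback (id : M → M) α = α := by
  funext x
  rw [rawPullback, tangentMapAt_id]
  ext v
  rfl

theorem rawPullback_comp_apply {q : ℕ} {f : M → N} {g : N → P} {x : M}
    (hg : MDifferentiableAt (𝓡 n) (𝓡 n) g (f x)) (hf : MDifferentiableAt (𝓡 n) (𝓡 n) f x)
    (α : P → AltForm n q) :
    rawPullback (g ∘ f) α x = rawPullback f (rawPullback g α) x := by
  rw [rawPullback, tangentMapAt_comp hg hf]
  ext v
  rfl

theorem rawPullback_add {q : ℕ} (f : M → N) (α η : N → AltForm n q) :
    rawPullback f (α + η) = rawPullback f α + rawPullback f η := by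
  funext x; ext v; rfl

theorem rawPullback_smul {q : ℕ} (f : M → N) (c : ℝ) (α : N → AltForm n q) :
    rawPullback f (c • α) = c • rawPullback f α := by
  funext x; ext v; rfl

theorem two_le_smooth : minSmoothness ℝ 2 ≤ ∞ := by
  rw [minSmoothness_of_isRCLikeNormedField]
  exact WithTop.coe_le_coe.2 (le_top : (2 : ℕ∞) ≤ ⊤)

theorem finiteDimensional_altForm (n q : ℕ) : FiniteDimensional ℝ (AltForm n q) := by
  let L : AltForm n q →ₗ[ℝ] MultilinearMap ℝ (fun _ : Fin q => Model n) ℝ :=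
    { toFun := fun f => f.toContinuousMultilinearMap.toMultilinearMap
      map_add' := fun _ _ => rfl
      map_smul' := fun _ _ => rfl }
  refine FiniteDimensional.of_injective L ?_
  intro f g h
  ext v
  exact congrArg (fun F : MultilinearMap ℝ (fun _ : Fin q => Model n) ℝ => F v) h

theorem finiteDimensional_multilinear (n q : ℕ) :
    FiniteDimensional ℝ (ContinuousMultilinearMap ℝ (fun _ : Fin q => Model n) ℝ) := by
  let L : ContinuousMultilinearMap ℝ (fun _ : Fin q => Model n) ℝ →ₗ[ℝ]
      MultilinearMap ℝ (fun _ : Fin q => Model n) ℝ :=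
    { toFun := fun f => f.toMultilinearMap
      map_add' := fun _ _ => rfl
      map_smul' := fun _ _ => rfl }
  refine FiniteDimensional.of_injective L ?_
  intro f g h
  ext v
  exact congrArg (fun F : MultilinearMap ℝ (fun _ : Fin q => Model n) ℝ => F v) h

theorem contDiffAt_compContinuousLinearMap {q : ℕ} {α : Model n → AltForm n q}
    {A : Model n → Model n →L[ℝ] Model n} {y : Model n}
    (hα : ContDiffAt ℝ ∞ α y) (hA : ContDiffAt ℝ ∞ A y) :
    ContDiffAt ℝ ∞ (fun z => (α z).compContinuousLinearMap (A z)) y := by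
  have := finiteDimensional_multilinear n q
  let T : AltForm n q →L[ℝ] ContinuousMultilinearMap ℝ (fun _ : Fin q => Model n) ℝ :=
    ContinuousAlternatingMap.toContinuousMultilinearMapCLM ℝ
  obtain ⟨S, hS⟩ := LinearMap.exists_leftInverse_of_injective
    (T : AltForm n q →ₗ[ℝ] ContinuousMultilinearMap ℝ (fun _ : Fin q => Model n) ℝ)
    (LinearMap.ker_eq_bot.2 ContinuousAlternatingMap.toContinuousMultilinearMap_injective)
  have h1 : ContDiffAt ℝ ∞
      (fun z => (T (α z)).compContinuousLinearMap fun _ : Fin q => A z) y :=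
    ContDiffAt.comp (n := ∞) y
      (g := fun F : (Fin q → Model n →L[ℝ] Model n) ×
        ContinuousMultilinearMap ℝ (fun _ : Fin q => Model n) ℝ =>
          F.2.compContinuousLinearMap F.1)
      (f := fun z => (fun _ => A z, T (α z)))
      ContinuousMultilinearMap.analyticAt_uncurry_compContinuousLinearMap.contDiffAt
      ((contDiffAt_pi.2 fun _ => hA).prodMk (T.contDiff.contDiffAt.comp y hα))
  have h3 : ContDiffAt ℝ ∞ (fun z => LinearMap.toContinuousLinearMap S
      ((T (α z)).compContinuousLinearMap fun _ : Fin q => A z)) y :=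
    (LinearMap.toContinuousLinearMap S).contDiff.contDiffAt.comp y h1
  refine h3.congr_of_eventuallyEq (Filter.Eventually.of_forall fun z => ?_)
  exact (LinearMap.congr_fun hS ((α z).compContinuousLinearMap (A z))).symm


theorem mdiffAt {f : M → N} {x : M} (h : ContMDiffAt (𝓡 n) (𝓡 n) ∞ f x) :
    MDifferentiableAt (𝓡 n) (𝓡 n) f x :=
  h.mdifferentiableAt (by simp)

theorem IsSmoothForm.contDiffAt {q : ℕ} {α : M → AltForm n q} (h : IsSmoothForm α) {x : M}
    {y : Model n} (hy : y ∈ (chartAt (Model n) x).target) :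
    ContDiffAt ℝ ∞ (chartRep α x) y :=
  (h x).contDiffAt ((chartAt (Model n) x).open_target.mem_nhds hy)

theorem chartRep_add {q : ℕ} (α η : M → AltForm n q) (x : M) :
    chartRep (α + η) x = chartRep α x + chartRep η x :=
  rawPullback_add _ _ _

theorem chartRep_smul {q : ℕ} (c : ℝ) (α : M → AltForm n q) (x : M) :
    chartRep (c • α) x = c • chartRep α x :=
  rawPullback_smul _ _ _

variable [IsManifold (𝓡 n) ∞ M] [IsManifold (𝓡 n) ∞ N]

theorem contMDiffAt_chart {x z : M} (hz : z ∈ (chartAt (Model n) x).source) :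
    ContMDiffAt (𝓡 n) (𝓡 n) ∞ (chartAt (Model n) x) z :=
  (contMDiffOn_chart (I := 𝓡 n) (x := x)).contMDiffAt
    ((chartAt (Model n) x).open_source.mem_nhds hz)

theorem contMDiffAt_chart_symm {x : M} {y : Model n} (hy : y ∈ (chartAt (Model n) x).target) :
    ContMDiffAt (𝓡 n) (𝓡 n) ∞ (chartAt (Model n) x).symm y :=
  (contMDiffOn_chart_symm (I := 𝓡 n) (x := x)).contMDiffAt
    ((chartAt (Model n) x).open_target.mem_nhds hy)

/-- The coordinate expression of a map. -/
def transition (f : M → N) (x : M) (x' : N) : Model n → Model n :=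
  (chartAt (Model n) x') ∘ f ∘ (chartAt (Model n) x).symm

theorem contDiffAt_transition {f : M → N} (hf : ContMDiff (𝓡 n) (𝓡 n) ∞ f) {x : M} {x' : N}
    {y : Model n} (hy : y ∈ (chartAt (Model n) x).target)
    (hy' : f ((chartAt (Model n) x).symm y) ∈ (chartAt (Model n) x').source) :
    ContDiffAt ℝ ∞ (transition f x x') y := by
  have h : ContMDiffAt (𝓡 n) (𝓡 n) ∞ (transition f x x') y :=
    (contMDiffAt_chart hy').comp y ((hf _).comp y (contMDiffAt_chart_symm hy))
  exact h.contDiffAt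

theorem chartRep_pullback_apply {q : ℕ} {f : M → N} (hf : ContMDiff (𝓡 n) (𝓡 n) ∞ f)
    (α : N → AltForm n q) {x : M} {x' : N}
    {y : Model n} (hy : y ∈ (chartAt (Model n) x).target)
    (hy' : f ((chartAt (Model n) x).symm y) ∈ (chartAt (Model n) x').source) :
    chartRep (rawPullback f α) x y =
      (chartRep α x' (transition f x x' y)).compContinuousLinearMap
        (fderiv ℝ (transition f x x') y) := by
  have hσ := contMDiffAt_chart_symm hy
  have hfσ : ContMDiffAt (𝓡 n) (𝓡 n) ∞ (f ∘ (chartAt (Model n) x).symm) y := (hf _).comp y hσ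
  have ht : transition f x x' y ∈ (chartAt (Model n) x').target :=
    (chartAt (Model n) x').map_source hy'
  have hτ : ContMDiffAt (𝓡 n) (𝓡 n) ∞ (transition f x x') y :=
    (contDiffAt_transition hf hy hy').contMDiffAt
  have e : ((chartAt (Model n) x').symm ∘ transition f x x') =ᶠ[nhds y]
      (f ∘ (chartAt (Model n) x).symm) := by
    have : ∀ᶠ z in nhds y, (f ∘ (chartAt (Model n) x).symm) z ∈ (chartAt (Model n) x').source :=
      hfσ.continuousAt ((chartAt (Model n) x').open_source.mem_nhds hy')
    filter_upwards [this] with z hz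
    exact (chartAt (Model n) x').left_inv hz
  rw [← tangentMapAt_eq_fderiv]
  change rawPullback (chartAt (Model n) x).symm (rawPullback f α) y =
    rawPullback (transition f x x') (rawPullback (chartAt (Model n) x').symm α) y
  rw [← rawPullback_comp_apply (mdiffAt (hf _)) (mdiffAt hσ),
    ← rawPullback_comp_apply (mdiffAt (contMDiffAt_chart_symm ht)) (mdiffAt hτ)]
  rw [rawPullback, rawPullback, tangentMapAt_congr e, e.self_of_nhds]

theorem chartRep_pullback_eventuallyEq {q : ℕ} {f : M → N} (hf : ContMDiff (𝓡 n) (𝓡 n) ∞ f)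
    (α : N → AltForm n q) {x : M} {x' : N}
    {y : Model n} (hy : y ∈ (chartAt (Model n) x).target)
    (hy' : f ((chartAt (Model n) x).symm y) ∈ (chartAt (Model n) x').source) :
    chartRep (rawPullback f α) x =ᶠ[nhds y] fun z =>
      (chartRep α x' (transition f x x' z)).compContinuousLinearMap
        (fderiv ℝ (transition f x x') z) := by
  have hfσ : ContMDiffAt (𝓡 n) (𝓡 n) ∞ (f ∘ (chartAt (Model n) x).symm) y :=
    (hf _).comp y (contMDiffAt_chart_symm hy)
  have h1 : ∀ᶠ z in nhds y, (f ∘ (chartAt (Model n) x).symm) z ∈ (chartAt (Model n) x').source :=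
    hfσ.continuousAt ((chartAt (Model n) x').open_source.mem_nhds hy')
  filter_upwards [h1, (chartAt (Model n) x).open_target.mem_nhds hy] with z hz hz'
  exact chartRep_pullback_apply hf α hz' hz

theorem IsSmoothForm.pullback {q : ℕ} {f : M → N} (hf : ContMDiff (𝓡 n) (𝓡 n) ∞ f)
    {α : N → AltForm n q} (h : IsSmoothForm α) : IsSmoothForm (rawPullback f α) := by
  intro x y hy
  have hy' := mem_chart_source (Model n) (f ((chartAt (Model n) x).symm y))
  have hτ := contDiffAt_transition hf hy hy'
  refine ContDiffAt.contDiffWithinAt (ContDiffAt.congr_of_eventuallyEq ?_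
    (chartRep_pullback_eventuallyEq hf α hy hy'))
  refine contDiffAt_compContinuousLinearMap ?_ ?_
  · exact (h.contDiffAt ((chartAt (Model n) _).map_source hy')).comp y hτ
  · exact hτ.fderiv_right (by simp)

theorem extDeriv_chartRep_pullback {q : ℕ} {f : M → N} (hf : ContMDiff (𝓡 n) (𝓡 n) ∞ f)
    {α : N → AltForm n q} (h : IsSmoothForm α) {x : M} {x' : N}
    {y : Model n} (hy : y ∈ (chartAt (Model n) x).target)
    (hy' : f ((chartAt (Model n) x).symm y) ∈ (chartAt (Model n) x').source) :
    extDeriv (chartRep (rawPullback f α) x) y =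
      (extDeriv (chartRep α x') (transition f x x' y)).compContinuousLinearMap
        (fderiv ℝ (transition f x x') y) := by
  rw [(chartRep_pullback_eventuallyEq hf α hy hy').extDeriv_eq]
  exact extDeriv_pullback
    ((h.contDiffAt ((chartAt (Model n) x').map_source hy')).differentiableAt (by simp))
    (contDiffAt_transition hf hy hy') two_le_smooth

/-- In an arbitrary preferred chart the exterior derivative is computed by the exterior
derivative of the coordinate expression. -/
theorem chartRep_rawD {q : ℕ} {α : M → AltForm n q} (h : IsSmoothForm α) {x : M}
    {y : Model n} (hy : y ∈ (chartAt (Model n) x).target) :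
    chartRep (rawD α) x y = extDeriv (chartRep α x) y := by
  have hy' := mem_chart_source (Model n) ((chartAt (Model n) x).symm y)
  have key := extDeriv_chartRep_pullback (f := (id : M → M)) contMDiff_id h hy hy'
  rw [rawPullback_id] at key
  rw [key, ← tangentMapAt_eq_fderiv]
  have e : tangentMapAt (transition (id : M → M) x ((chartAt (Model n) x).symm y)) y =
      (tangentMapAt (chartAt (Model n) ((chartAt (Model n) x).symm y))
        ((chartAt (Model n) x).symm y)).comp (tangentMapAt (chartAt (Model n) x).symm y) :=
    tangentMapAt_comp (mdiffAt (contMDiffAt_chart hy')) (mdiffAt (contMDiffAt_chart_symm hy))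
  rw [e]
  ext v
  rfl

theorem IsSmoothForm.rawD {q : ℕ} {α : M → AltForm n q} (h : IsSmoothForm α) :
    IsSmoothForm (rawD α) := by
  intro x
  refine ContDiffOn.congr ?_ (fun y hy => chartRep_rawD h hy)
  intro y hy
  have h1 : ContDiffAt ℝ ∞ (fderiv ℝ (chartRep α x)) y :=
    (h.contDiffAt hy).fderiv_right (by simp)
  exact ((ContinuousAlternatingMap.alternatizeUncurryFinCLM ℝ (Model n) ℝ).contDiff.contDiffAt.comp
    y h1).contDiffWithinAt

theorem rawD_rawD {q : ℕ} {α : M → AltForm n q} (h : IsSmoothForm α) :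
    EquivariantForms.rawD (EquivariantForms.rawD α) = 0 := by
  funext x
  have hy := mem_chart_target (Model n) x
  have e : chartRep (EquivariantForms.rawD α) x =ᶠ[nhds (chartAt (Model n) x x)]
      extDeriv (chartRep α x) := by
    filter_upwards [(chartAt (Model n) x).open_target.mem_nhds hy] with z hz
    exact chartRep_rawD h hz
  rw [EquivariantForms.rawD, e.extDeriv_eq,
    extDeriv_extDeriv_apply (h.contDiffAt hy) two_le_smooth]
  ext v
  rfl

theorem rawD_pullback {q : ℕ} {f : M → N} (hf : ContMDiff (𝓡 n) (𝓡 n) ∞ f)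
    {α : N → AltForm n q} (h : IsSmoothForm α) :
    EquivariantForms.rawD (rawPullback f α) = rawPullback f (EquivariantForms.rawD α) := by
  funext x
  have hx := mem_chart_source (Model n) x
  have hy := mem_chart_target (Model n) x
  have hl : (chartAt (Model n) x).symm (chartAt (Model n) x x) = x :=
    (chartAt (Model n) x).left_inv hx
  have hy' : f ((chartAt (Model n) x).symm (chartAt (Model n) x x)) ∈
      (chartAt (Model n) (f x)).source := by
    rw [hl]; exact mem_chart_source _ _
  have hτ := (contDiffAt_transition hf hy hy').contMDiffAt
  rw [EquivariantForms.rawD, extDeriv_chartRep_pullback hf h hy hy', ← tangentMapAt_eq_fderiv]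
  have e : (transition f x (f x) ∘ chartAt (Model n) x) =ᶠ[nhds x]
      (chartAt (Model n) (f x) ∘ f) := by
    filter_upwards [(chartAt (Model n) x).open_source.mem_nhds hx] with z hz
    simp [transition, (chartAt (Model n) x).left_inv hz]
  have e1 := tangentMapAt_comp (mdiffAt hτ) (mdiffAt (contMDiffAt_chart hx))
  have e2 : tangentMapAt (chartAt (Model n) (f x) ∘ f) x = _ :=
    tangentMapAt_comp (mdiffAt (contMDiffAt_chart (mem_chart_source (Model n) (f x))))
      (mdiffAt (hf x))
  have e3 : transition f x (f x) (chartAt (Model n) x x) = chartAt (Model n) (f x) (f x) :=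
    e.self_of_nhds
  rw [tangentMapAt_congr e, e2] at e1
  ext v
  have e4 : ∀ i, _ := fun i => congrArg (fun L : Model n →L[ℝ] Model n => L (v i)) e1
  simp only [ContinuousAlternatingMap.compContinuousLinearMap_apply, rawPullback,
    EquivariantForms.rawD, e3]
  congr 1
  funext i
  exact (e4 i).symm

theorem rawD_add {q : ℕ} {α η : M → AltForm n q} (hα : IsSmoothForm α) (hη : IsSmoothForm η) :
    EquivariantForms.rawD (α + η) = EquivariantForms.rawD α + EquivariantForms.rawD η := by
  funext x
  have hy := mem_chart_target (Model n) x
  rw [EquivariantForms.rawD, chartRep_add, extDeriv_add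
    ((hα.contDiffAt hy).differentiableAt (by simp)) ((hη.contDiffAt hy).differentiableAt (by simp))]
  ext v
  rfl

theorem rawD_smul {q : ℕ} (c : ℝ) (α : M → AltForm n q) :
    EquivariantForms.rawD (c • α) = c • EquivariantForms.rawD α := by
  funext x
  rw [EquivariantForms.rawD, chartRep_smul, extDeriv_smul]
  ext v
  rfl

end Raw

/-! ### The de Rham complex -/

section DeRham
variable (n : ℕ) (M : Type*) [TopologicalSpace M] [ChartedSpace (Model n) M]
  [IsManifold (𝓡 n) ∞ M]

/-- The space `Ω^q(M)` of smooth `q`-forms on `M`. -/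
def smoothForms (q : ℕ) : Submodule ℝ (M → AltForm n q) where
  carrier := {α | IsSmoothForm α}
  add_mem' {α β} hα hβ := fun x => by
    rw [chartRep_add]
    exact (hα x).add (hβ x)
  zero_mem' := fun x => by
    have h : chartRep (0 : M → AltForm n q) x = 0 := by
      funext y; ext v; rfl
    rw [h]
    exact contDiffOn_const
  smul_mem' c α hα := fun x => by
    rw [chartRep_smul]
    exact contDiffOn_const.smul (hα x)

/-- The real vector space `Ω^q(M)`, as a type. -/
def Form (q : ℕ) : Type _ := ↥(smoothForms n M q)

instance (q : ℕ) : AddCommGroup (Form n M q) :=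
  inferInstanceAs (AddCommGroup ↥(smoothForms n M q))

instance (q : ℕ) : Module ℝ (Form n M q) :=
  inferInstanceAs (Module ℝ ↥(smoothForms n M q))

/-- The exterior derivative `d : Ω^q(M) → Ω^{q+1}(M)`. -/
def d (q : ℕ) : Form n M q →ₗ[ℝ] Form n M (q + 1) where
  toFun α := ⟨rawD α.1, IsSmoothForm.rawD α.2⟩
  map_add' α β := Subtype.ext (rawD_add α.2 β.2)
  map_smul' c α := Subtype.ext (rawD_smul c α.1)

theorem d_d (q : ℕ) (α : Form n M q) : d n M (q + 1) (d n M q α) = 0 :=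
  Subtype.ext (rawD_rawD α.2)

/-- Closed `q`-forms. -/
def closedForms (q : ℕ) : Submodule ℝ (Form n M q) := LinearMap.ker (d n M q)

/-- Exact `q`-forms. -/
def exactForms : (q : ℕ) → Submodule ℝ (Form n M q)
  | 0 => ⊥
  | q + 1 => LinearMap.range (d n M q)

theorem exactForms_le_closedForms (q : ℕ) : exactForms n M q ≤ closedForms n M q := by
  cases q with
  | zero => exact bot_le
  | succ q =>
    rintro _ ⟨α, rfl⟩
    exact d_d n M q α

/-- The real (de Rham) cohomology `H^q(M)`. -/
abbrev DeRhamCohomology (q : ℕ) : Type _ :=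
  closedForms n M q ⧸ (exactForms n M q).submoduleOf (closedForms n M q)

variable {n M}

/-- The pull back of forms by a smooth map `f : M → M`. -/
def pullback (f : M → M) (hf : ContMDiff (𝓡 n) (𝓡 n) ∞ f) (q : ℕ) :
    Form n M q →ₗ[ℝ] Form n M q where
  toFun α := ⟨rawPullback f α.1, IsSmoothForm.pullback hf α.2⟩
  map_add' α β := Subtype.ext (rawPullback_add f α.1 β.1)
  map_smul' c α := Subtype.ext (rawPullback_smul f c α.1)

theorem d_pullback (f : M → M) (hf : ContMDiff (𝓡 n) (𝓡 n) ∞ f) (q : ℕ) (α : Form n M q) :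
    d n M q (pullback f hf q α) = pullback f hf (q + 1) (d n M q α) :=
  Subtype.ext (rawD_pullback hf α.2)

end DeRham

/-! ### Cohomology of a group with values in a right module

A right `G`-module over `ℝ` is a representation of the opposite group `Gᵐᵒᵖ`; the element
`a · g` is `ρ (MulOpposite.op g) a`. -/

section GroupCohomology
variable {G A : Type*} [Group G] [AddCommGroup A] [Module ℝ A]

/-- Nonhomogeneous cochains `C^p(G, A)`. -/
abbrev Cochain (G A : Type*) (p : ℕ) : Type _ := (Fin p → G) → A

/-- The differential
`(D f)(g₁, …, g_{p+1}) = f(g₂, …, g_{p+1}) + ∑_{i=1}^p (-1)^i f(g₁, …, g_i g_{i+1}, …, g_{p+1})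
  + (-1)^{p+1} f(g₁, …, g_p) · g_{p+1}`. -/
def coboundary (ρ : Representation ℝ Gᵐᵒᵖ A) (p : ℕ) :
    Cochain G A p →ₗ[ℝ] Cochain G A (p + 1) where
  toFun f g := f (Fin.tail g)
    + ∑ i : Fin p, (-1 : ℝ) ^ ((i : ℕ) + 1) • f (Fin.contractNth i.castSucc (· * ·) g)
    + (-1 : ℝ) ^ (p + 1) • ρ (MulOpposite.op (g (Fin.last p))) (f (Fin.init g))
  map_add' f f' := by
    funext g
    simp only [Pi.add_apply, smul_add, Finset.sum_add_distrib, map_add]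
    abel
  map_smul' c f := by
    funext g
    simp only [Pi.smul_apply, map_smul, RingHom.id_apply, smul_add, Finset.smul_sum]
    simp only [smul_comm c]

/-- Cocycles of degree `p`. -/
def groupCocycles (ρ : Representation ℝ Gᵐᵒᵖ A) (p : ℕ) : Submodule ℝ (Cochain G A p) :=
  LinearMap.ker (coboundary ρ p)

/-- Coboundaries of degree `p`. -/
def groupCoboundaries (ρ : Representation ℝ Gᵐᵒᵖ A) : (p : ℕ) → Submodule ℝ (Cochain G A p)
  | 0 => ⊥
  | p + 1 => LinearMap.range (coboundary ρ p)

/-- The cohomology `H^p(G, A)` of `G` with values in the right `G`-module `A`. -/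
abbrev RightGroupCohomology (ρ : Representation ℝ Gᵐᵒᵖ A) (p : ℕ) : Type _ :=
  groupCocycles ρ p ⧸ (groupCoboundaries ρ p).submoduleOf (groupCocycles ρ p)

end GroupCohomology

/-! ### `G`-manifolds and the double complex -/

/-- `G` acts on `M` by diffeomorphisms. -/
class SmoothAction (n : ℕ) (G M : Type*) [Group G] [TopologicalSpace M]
    [ChartedSpace (Model n) M] [MulAction G M] : Prop where
  contMDiff_smul : ∀ g : G, ContMDiff (𝓡 n) (𝓡 n) ∞ (fun x : M => g • x)

section Double
variable (n : ℕ) (G M : Type*) [Group G] [TopologicalSpace M] [ChartedSpace (Model n) M]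
  [IsManifold (𝓡 n) ∞ M] [MulAction G M] [SmoothAction n G M]

/-- The right action of `G` on `Ω^q(M)` by pull backs, `α · g = g^* α`. -/
def formRep (q : ℕ) : Representation ℝ Gᵐᵒᵖ (Form n M q) where
  toFun g := pullback (fun x : M => g.unop • x) (SmoothAction.contMDiff_smul g.unop) q
  map_one' := by
    refine LinearMap.ext fun α => Subtype.ext ?_
    have h : (fun x : M => (1 : Gᵐᵒᵖ).unop • x) = id := by
      funext x; exact one_smul G x
    change rawPullback (fun x : M => (1 : Gᵐᵒᵖ).unop • x) α.1 = α.1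
    rw [h, rawPullback_id]
  map_mul' g g' := by
    refine LinearMap.ext fun α => Subtype.ext ?_
    have h : (fun x : M => (g * g').unop • x) =
        (fun x : M => g'.unop • x) ∘ (fun x : M => g.unop • x) := by
      funext x; exact mul_smul g'.unop g.unop x
    change rawPullback (fun x : M => (g * g').unop • x) α.1 =
      rawPullback (fun x : M => g.unop • x) (rawPullback (fun x : M => g'.unop • x) α.1)
    rw [h]
    funext x
    exact rawPullback_comp_apply (mdiffAt (SmoothAction.contMDiff_smul g'.unop _))
      (mdiffAt (SmoothAction.contMDiff_smul g.unop _)) α.1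

theorem d_formRep (q : ℕ) (g : Gᵐᵒᵖ) (α : Form n M q) :
    d n M q (formRep n G M q g α) = formRep n G M (q + 1) g (d n M q α) :=
  d_pullback _ (SmoothAction.contMDiff_smul g.unop) q α

theorem formRep_mem_closedForms (q : ℕ) (g : Gᵐᵒᵖ) (α : Form n M q)
    (hα : α ∈ closedForms n M q) : formRep n G M q g α ∈ closedForms n M q := by
  have h : d n M q α = 0 := hα
  change d n M q (formRep n G M q g α) = 0
  rw [d_formRep, h, map_zero]

theorem formRep_mem_exactForms (q : ℕ) (g : Gᵐᵒᵖ) (α : Form n M q)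
    (hα : α ∈ exactForms n M q) : formRep n G M q g α ∈ exactForms n M q := by
  cases q with
  | zero =>
    have h : α = 0 := hα
    rw [h, map_zero]
    exact Submodule.zero_mem _
  | succ q =>
    obtain ⟨β, rfl⟩ := hα
    exact ⟨formRep n G M q g β, d_formRep n G M q g β⟩

/-- The right action of `G` on `H^q(M)` induced by its action on forms. -/
def deRhamRep (q : ℕ) : Representation ℝ Gᵐᵒᵖ (DeRhamCohomology n M q) where
  toFun g := Submodule.mapQ _ _
    ((formRep n G M q g).restrict (formRep_mem_closedForms n G M q g))
    (fun α hα => formRep_mem_exactForms n G M q g α.1 hα)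
  map_one' := by
    refine LinearMap.ext fun a => ?_
    obtain ⟨α, rfl⟩ := Submodule.Quotient.mk_surjective _ a
    refine congrArg Submodule.Quotient.mk (Subtype.ext ?_)
    exact LinearMap.congr_fun (map_one (formRep n G M q)) α.1
  map_mul' g g' := by
    refine LinearMap.ext fun a => ?_
    obtain ⟨α, rfl⟩ := Submodule.Quotient.mk_surjective _ a
    refine congrArg Submodule.Quotient.mk (Subtype.ext ?_)
    exact LinearMap.congr_fun (map_mul (formRep n G M q) g g') α.1

/-- The `G`-invariant forms `Ω^q(M)^G`. -/
abbrev invariantForms (q : ℕ) : Submodule ℝ (Form n M q) := (formRep n G M q).invariants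

/-- `δ' : C^p(G, Ω^q(M)) → C^{p+1}(G, Ω^q(M))`. -/
def delta' (p q : ℕ) : Cochain G (Form n M q) p →ₗ[ℝ] Cochain G (Form n M q) (p + 1) :=
  coboundary (formRep n G M q) p

/-- `δ'' : C^p(G, Ω^q(M)) → C^p(G, Ω^{q+1}(M))`, `(δ'' c)(g) = (-1)^p d (c(g))`. -/
def delta'' (p q : ℕ) : Cochain G (Form n M q) p →ₗ[ℝ] Cochain G (Form n M (q + 1)) p where
  toFun c g := (-1 : ℝ) ^ p • d n M q (c g)
  map_add' c c' := by funext g; simp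
  map_smul' r c := by funext g; simp [smul_comm r]

/-- Families `(c_{p,q})` with `c_{p,q} ∈ C^p(G, Ω^q(M))` for all `p, q ≥ 0`. The elements of total
degree `N` of the double complex are the families supported on `p + q = N`. -/
abbrev DoubleCochain : Type _ := (p q : ℕ) → Cochain G (Form n M q) p

variable {n G M}

/-- `(δ' c)_{p,q}` for a family `c`. -/
def deltaH (c : DoubleCochain n G M) : DoubleCochain n G M
  | 0, _ => 0
  | p + 1, q => delta' n G M p q (c p q)

/-- `(δ'' c)_{p,q}` for a family `c`. -/
def deltaV (c : DoubleCochain n G M) : DoubleCochain n G M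
  | _, 0 => 0
  | p, q + 1 => delta'' n G M p q (c p q)

variable (n G M)

/-- The total differential `δ = δ' + δ''`. -/
def totalDelta : DoubleCochain n G M →ₗ[ℝ] DoubleCochain n G M where
  toFun c := deltaH c + deltaV c
  map_add' c c' := by
    funext p q
    cases p <;> cases q <;> (simp [deltaH, deltaV]; try abel)
  map_smul' r c := by
    funext p q
    cases p <;> cases q <;> simp [deltaH, deltaV]

/-- The degree `N` part of `F_{1,r}(G, M, Ω(M)) = ⨁_{p ≥ r} C^p(G, Ω(M))`. For `r = 0` this is the
degree `N` part of the whole complex `C^{**}(G, Ω(M))`. -/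
def filtration (r N : ℕ) : Submodule ℝ (DoubleCochain n G M) where
  carrier := {c | ∀ p q, p < r ∨ p + q ≠ N → c p q = 0}
  add_mem' {c c'} hc hc' := fun p q h => by simp [hc p q h, hc' p q h]
  zero_mem' := fun _ _ _ => rfl
  smul_mem' a c hc := fun p q h => by simp [hc p q h]

/-- Degree `N` cocycles of the complex `F_{1,r}(G, M, Ω(M))`. -/
def filtrationCocycles (r N : ℕ) : Submodule ℝ (DoubleCochain n G M) :=
  filtration n G M r N ⊓ LinearMap.ker (totalDelta n G M)

/-- Degree `N` coboundaries of the complex `F_{1,r}(G, M, Ω(M))`. -/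
def filtrationCoboundaries (r : ℕ) : ℕ → Submodule ℝ (DoubleCochain n G M)
  | 0 => ⊥
  | N + 1 => (filtration n G M r N).map (totalDelta n G M)

/-- The cohomology `H^N(F_{1,r}(G, M, Ω(M)))`. -/
abbrev FiltrationCohomology (r N : ℕ) : Type _ :=
  filtrationCocycles n G M r N ⧸
    (filtrationCoboundaries n G M r N).submoduleOf (filtrationCocycles n G M r N)

/-- The cohomology `H^N(G, M, Ω(M))` of the total complex `C^{**}(G, Ω(M)) = F_{1,0}`. -/
abbrev TotalCohomology (N : ℕ) : Type _ := FiltrationCohomology n G M 0 N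

theorem filtration_le (r N : ℕ) : filtration n G M r N ≤ filtration n G M 0 N :=
  fun _ hc p q h => hc p q (Or.inr (h.resolve_left (Nat.not_lt_zero p)))

theorem filtrationCocycles_le (r N : ℕ) :
    filtrationCocycles n G M r N ≤ filtrationCocycles n G M 0 N :=
  inf_le_inf_right _ (filtration_le n G M r N)

theorem filtrationCoboundaries_le (r N : ℕ) :
    filtrationCoboundaries n G M r N ≤ filtrationCoboundaries n G M 0 N := by
  cases N with
  | zero => exact le_rfl
  | succ N => exact Submodule.map_mono (filtration_le n G M r N)

/-- The homomorphism `h_r : H^N(F_{1,r}(G, M, Ω(M))) → H^N(G, M, Ω(M))` induced by inclusion. -/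
def hMap (r N : ℕ) : FiltrationCohomology n G M r N →ₗ[ℝ] TotalCohomology n G M N :=
  Submodule.mapQ _ _ (Submodule.inclusion (filtrationCocycles_le n G M r N))
    (fun c hc => filtrationCoboundaries_le n G M r N (x := c.1) hc)

variable {n G M}

/-- The image of a form `α ∈ Ω^m(M) = C^0(G, Ω^m(M))` in the double complex. -/
def formCochain {m : ℕ} (α : Form n M m) : DoubleCochain n G M :=
  Pi.single 0 (Pi.single m fun _ => α)

theorem formCochain_mem {m : ℕ} (α : Form n M m) (hcl : α ∈ closedForms n M m)
    (hinv : α ∈ invariantForms n G M m) :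
    formCochain α ∈ filtrationCocycles n G M 0 m := by
  have hz : ∀ p q, p ≠ 0 ∨ q ≠ m → formCochain (G := G) α p q = 0 := by
    intro p q h
    by_cases hp : p = 0
    · subst hp
      have hq : q ≠ m := by simpa using h
      simp [formCochain, Pi.single_eq_of_ne hq]
    · simp [formCochain, Pi.single_eq_of_ne hp]
  have he : formCochain (G := G) α 0 m = fun _ => α := by simp [formCochain]
  refine ⟨fun p q h => hz p q ?_, ?_⟩
  · by_contra hcon
    push Not at hcon
    obtain ⟨rfl, rfl⟩ := hcon
    simp at h
  · change deltaH (formCochain α) + deltaV (formCochain α) = 0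
    have hH : deltaH (formCochain (G := G) α) = 0 := by
      funext p q
      cases p with
      | zero => rfl
      | succ p =>
        change delta' n G M p q (formCochain α p q) = 0
        by_cases h : p ≠ 0 ∨ q ≠ m
        · rw [hz p q h, map_zero]
        · push Not at h
          obtain ⟨rfl, rfl⟩ := h
          rw [he]
          funext g
          have := hinv (MulOpposite.op (g (Fin.last 0)))
          have h0 : (formRep n G M q) (MulOpposite.op (g 0)) α = α := this
          simp [delta', coboundary, h0]
    have hV : deltaV (formCochain (G := G) α) = 0 := by
      funext p q
      cases q with
      | zero => rfl
      | succ q =>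
        change delta'' n G M p q (formCochain α p q) = 0
        by_cases h : p ≠ 0 ∨ q ≠ m
        · rw [hz p q h, map_zero]
        · push Not at h
          obtain ⟨rfl, rfl⟩ := h
          rw [he]
          funext g
          have : d n M q α = 0 := hcl
          simp [delta'', this]
    rw [hH, hV, add_zero]

/-- The class `h(ω) ∈ H^m(G, M, Ω(M))` of a closed `G`-invariant `m`-form `ω`. -/
def hClass {m : ℕ} (α : Form n M m) (hcl : α ∈ closedForms n M m)
    (hinv : α ∈ invariantForms n G M m) : TotalCohomology n G M m :=
  Submodule.Quotient.mk ⟨formCochain α, formCochain_mem α hcl hinv⟩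

/-- The sequence `φ_{0,m-1}, φ_{1,m-2}, …, φ_{p,q}`, where `m = p + q + 1` and
`φ_{i,j} ∈ C^i(G, Ω^j(M))`, is a zig-zag for the `m`-form `α`: `α = -d φ_{0,m-1}` and
`δ' φ_{i-1,m-i} + δ'' φ_{i,m-i-1} = 0` for `i = 1, …, p`. Only the components `φ i j` with
`i ≤ p` and `i + j = p + q` matter. -/
structure IsZigZag {p q : ℕ} (α : Form n M (p + q + 1)) (φ : DoubleCochain n G M) : Prop where
  start : α = -d n M (p + q) (φ 0 (p + q) Fin.elim0)
  step : ∀ i j : ℕ, i + 1 ≤ p → (i + 1) + j = p + q →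
    delta' n G M i (j + 1) (φ i (j + 1)) + delta'' n G M (i + 1) j (φ (i + 1) j) = 0

/-- The cochain `z ∈ C^k(G, Ω^q(M))` has closed values, the induced cochain with values in `H^q(M)`
is a cocycle, and the cohomology class of this cocycle is `c ∈ H^k(G, H^q(M))`. -/
def Represents {k q : ℕ} (z : Cochain G (Form n M q) k)
    (c : RightGroupCohomology (deRhamRep n G M q) k) : Prop :=
  ∃ f : groupCocycles (deRhamRep n G M q) k,
    (∀ g : Fin k → G, ∃ hz : z g ∈ closedForms n M q,
      f.1 g = Submodule.Quotient.mk ⟨z g, hz⟩) ∧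
    Submodule.Quotient.mk f = c

end Double
end EquivariantForms

end

open EquivariantForms

/-! Column `i` of the double complex is `C^i(G, Ω^*(M))`. Since cochains are arbitrary functions on
`G^i`, it is exact in every positive form degree where the de Rham cohomology vanishes, here in
degrees `q + 1, …, q + p` with `q = m - p - 1`.

Existence: an exact `ω` has a primitive, and `δ'` of it is closed because `ω` is invariant. Taking
primitives `p` more times gives a zig-zag (`exists_isZigZag`). The sum `ψ` of its terms makes `ω +
δψ` a cocycle whose only component is `δ'φ_{p,q}`, hence a cocycle of `F_{p+1}` cohomologous to `ω`
(`IsZigZag.exists_filtrationCocycle`). In any cocycle of `F_{p+1}` the lowest component has closed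
values and exact `δ'`, so it represents a class.

Uniqueness: let two cocycles of `F_{p+1}` differ by some `δψ`. The same exactness moves `ψ` into
`F_p` without changing `δψ` (`exists_mem_filtration_totalDelta_eq`). The lowest components then
differ by `δ'ψ_{p,q}`, where `ψ_{p,q}` has closed values, up to exact values; so they represent the
same class (`represents_of_sub_mem_filtrationCoboundaries`). Replacing `ω` by `ω - dγ` with `γ`
invariant subtracts `δγ`, so the same comparison applies. -/

noncomputable section
namespace EquivariantForms

/-! ### Group cochains: `D ∘ D = 0` through homogeneous cochains. -/

section Coboundary
variable {G A B : Type*} [Group G] [AddCommGroup A] [Module ℝ A] [AddCommGroup B] [Module ℝ B]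

/-- The alternating sum over all pairs of successive face maps vanishes. -/
theorem sum_sum_succAbove_eq_zero {X : Type*} {p : ℕ} (F : (Fin p → X) → A)
    (x : Fin (p + 2) → X) :
    ∑ j : Fin (p + 2), (-1 : ℝ) ^ (j : ℕ) • ∑ i : Fin (p + 1),
      (-1 : ℝ) ^ (i : ℕ) • F (fun k => x (j.succAbove (i.succAbove k))) = 0 := by
  simp only [Finset.smul_sum, ← Finset.sum_product', Finset.univ_product_univ]
  -- Two entries can be omitted in either order. The pair `(j, i)` with `j ≤ i` cancels against `(i
  -- + 1, j)`: same omitted entries, opposite sign.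
  let S : Finset (Fin (p + 2) × Fin (p + 1)) := {ji | (ji.1 : ℕ) ≤ (ji.2 : ℕ)}
  rw [← Finset.sum_add_sum_compl S, ← eq_neg_iff_add_eq_zero, ← Finset.sum_neg_distrib]
  have mem : ∀ ji, ji ∈ S ↔ (ji.1 : ℕ) ≤ (ji.2 : ℕ) := by simp [S]
  let φ : ∀ ji : Fin (p + 2) × Fin (p + 1), ji ∈ S → Fin (p + 2) × Fin (p + 1) := fun ji h =>
    (ji.2.succ, ⟨ji.1, lt_of_le_of_lt ((mem ji).1 h) ji.2.is_lt⟩)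
  refine Finset.sum_bij φ ?_ ?_ ?_ ?_
  · rintro ⟨j, i⟩ h
    rw [mem] at h
    simp only [Finset.mem_compl, mem, φ, Fin.val_succ]
    simp only at h
    omega
  · rintro ⟨j, i⟩ h ⟨j', i'⟩ h' e
    simp only [φ, Prod.mk.injEq, Fin.ext_iff, Fin.val_succ] at e ⊢
    omega
  · rintro ⟨j, i⟩ h
    simp only [Finset.mem_compl, mem, not_le] at h
    refine ⟨(i.castSucc, j.pred (fun e => by simp [e] at h)), ?_, ?_⟩
    · simp only [mem, Fin.val_castSucc, Fin.val_pred]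
      omega
    · simp [φ]
  · rintro ⟨j, i⟩ h
    rw [mem] at h
    simp only at h
    simp only [φ, Fin.val_succ, smul_smul, pow_succ, ← neg_smul]
    congr 1
    · ring
    · congr 1
      funext k
      congr 1
      ext
      simp only [Fin.succAbove, Fin.lt_def, Fin.val_castSucc, Fin.val_succ]
      split_ifs <;> simp_all <;> omega

/-- The quotients of the successive entries of a tuple. -/
def successiveQuotients {p : ℕ} (x : Fin (p + 1) → G) (i : Fin p) : G :=
  x i.castSucc * (x i.succ)⁻¹

/-- The homogeneous cochain of a nonhomogeneous one. -/
def homogenize (ρ : Representation ℝ Gᵐᵒᵖ A) {p : ℕ} (f : Cochain G A p)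
    (x : Fin (p + 1) → G) : A :=
  ρ (MulOpposite.op (x (Fin.last p))) (f (successiveQuotients x))

theorem successiveQuotients_surjective {p : ℕ} (g : Fin p → G) :
    ∃ x : Fin (p + 1) → G, successiveQuotients x = g := by
  -- With `x_i = (g_1 ⋯ g_i)⁻¹` the quotient `x_i x_{i+1}⁻¹` telescopes to `g_{i+1}`.
  refine ⟨fun i => (Fin.partialProd g i)⁻¹, ?_⟩
  funext i
  simp [successiveQuotients, Fin.partialProd_succ]

/-- Group elements act invertibly and every tuple consists of successive quotients. Identities for
`D` may therefore be checked on homogeneous cochains. -/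
theorem eq_zero_of_homogenize_eq_zero (ρ : Representation ℝ Gᵐᵒᵖ A) {p : ℕ} {f : Cochain G A p}
    (h : homogenize ρ f = 0) : f = 0 := by
  funext g
  obtain ⟨x, rfl⟩ := successiveQuotients_surjective g
  have h1 := congrArg (ρ (MulOpposite.op (x (Fin.last p)))⁻¹) (congrFun h x)
  rw [homogenize, ← Module.End.mul_apply, ← map_mul, inv_mul_cancel, map_one] at h1
  simpa using h1

/-- Omitting an inner entry `b` of `…, a, b, c, …` merges two quotients: `(a b⁻¹)(b c⁻¹) = a c⁻¹`.
-/
theorem contractNth_successiveQuotients {p : ℕ} (x : Fin (p + 2) → G) (i : Fin p) :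
    Fin.contractNth i.castSucc (· * ·) (successiveQuotients x) =
      successiveQuotients fun k => x (i.succ.castSucc.succAbove k) := by
  funext k
  rcases lt_trichotomy (k : ℕ) i with h | h | h
  · rw [Fin.contractNth_apply_of_lt _ _ _ _ (by simpa using h)]
    have h1 : i.succ.castSucc.succAbove k.castSucc = k.castSucc.castSucc :=
      Fin.succAbove_of_castSucc_lt _ _ (show (k : ℕ) < i + 1 by omega)
    have h2 : i.succ.castSucc.succAbove k.succ = k.castSucc.succ :=
      Fin.succAbove_of_castSucc_lt _ _ (show (k : ℕ) + 1 < i + 1 by omega)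
    simp only [successiveQuotients, h1, h2]
  · obtain rfl : k = i := Fin.ext h
    rw [Fin.contractNth_apply_of_eq _ _ _ _ (by simp)]
    have h1 : k.succ.castSucc.succAbove k.castSucc = k.castSucc.castSucc :=
      Fin.succAbove_of_castSucc_lt _ _ (by simp [Fin.lt_def])
    have h2 : k.succ.castSucc.succAbove k.succ = k.succ.succ :=
      Fin.succAbove_of_le_castSucc _ _ le_rfl
    simp only [successiveQuotients, h1, h2]
    simp [mul_assoc, ← Fin.castSucc_succ]
  · rw [Fin.contractNth_apply_of_gt _ _ _ _ (by simpa using h)]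
    have h1 : i.succ.castSucc.succAbove k.castSucc = k.succ.castSucc :=
      Fin.succAbove_of_le_castSucc _ _ (show (i : ℕ) + 1 ≤ k by omega)
    have h2 : i.succ.castSucc.succAbove k.succ = k.succ.succ :=
      Fin.succAbove_of_le_castSucc _ _ (show (i : ℕ) + 1 ≤ k + 1 by omega)
    simp only [successiveQuotients, h1, h2]

theorem homogenize_coboundary (ρ : Representation ℝ Gᵐᵒᵖ A) {p : ℕ} (f : Cochain G A p)
    (x : Fin (p + 2) → G) :
    homogenize ρ (coboundary ρ p f) x =
      ∑ j : Fin (p + 2), (-1 : ℝ) ^ (j : ℕ) • homogenize ρ f (fun k => x (j.succAbove k)) := by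
  rw [Fin.sum_univ_succ, Fin.sum_univ_castSucc]
  simp only [homogenize, coboundary, LinearMap.coe_mk, AddHom.coe_mk, map_add, map_sum, map_smul]
  rw [← add_assoc]
  refine congrArg₂ _ (congrArg₂ _ ?_ (Finset.sum_congr rfl fun i _ => ?_)) ?_
  · simp only [Fin.coe_ofNat_eq_mod, Nat.zero_mod, pow_zero, one_smul, Fin.zero_succAbove]
    rfl
  · rw [contractNth_successiveQuotients]
    have h : i.castSucc.succ.succAbove (Fin.last p) = Fin.last (p + 1) := by
      rw [← Fin.succ_last]
      exact Fin.succAbove_of_le_castSucc _ _ (show (i : ℕ) + 1 ≤ p by omega)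
    rw [h]
    rfl
  · have h : ∀ k, (Fin.last p).succ.succAbove k = k.castSucc := fun k => by
      rw [Fin.succ_last, Fin.succAbove_last]
    simp only [h]
    -- Acting by `x_p x_{p+1}⁻¹` and then by `x_{p+1}` is acting by `x_p`, the last entry once
    -- `x_{p+1}` is omitted.
    rw [← Module.End.mul_apply, ← map_mul, ← MulOpposite.op_mul]
    simp [successiveQuotients]
    rfl

/-- `D ∘ D = 0`. -/
theorem coboundary_coboundary (ρ : Representation ℝ Gᵐᵒᵖ A) {p : ℕ} (f : Cochain G A p) :
    coboundary ρ (p + 1) (coboundary ρ p f) = 0 := by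
  refine eq_zero_of_homogenize_eq_zero ρ (funext fun x => ?_)
  rw [homogenize_coboundary]
  simp only [homogenize_coboundary]
  exact sum_sum_succAbove_eq_zero (homogenize ρ f) x

/-- `D` commutes with equivariant maps. -/
theorem coboundary_map (ρ : Representation ℝ Gᵐᵒᵖ A) (σ : Representation ℝ Gᵐᵒᵖ B) (T : A →ₗ[ℝ] B)
    (hT : ∀ g a, T (ρ g a) = σ g (T a)) {p : ℕ} (f : Cochain G A p) (g : Fin (p + 1) → G) :
    T (coboundary ρ p f g) = coboundary σ p (fun h => T (f h)) g := by
  simp [coboundary, hT]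

end Coboundary

/-! ### The double complex and its total differential. -/

section Double
variable {n : ℕ} {G M : Type*} [Group G] [TopologicalSpace M] [ChartedSpace (Model n) M]
  [IsManifold (𝓡 n) ∞ M] [MulAction G M] [SmoothAction n G M]

theorem delta'_delta' {p q : ℕ} (c : Cochain G (Form n M q) p) :
    delta' n G M (p + 1) q (delta' n G M p q c) = 0 :=
  coboundary_coboundary _ c

theorem delta''_apply {p q : ℕ} (c : Cochain G (Form n M q) p) (g : Fin p → G) :
    delta'' n G M p q c g = (-1 : ℝ) ^ p • d n M q (c g) := rfl

theorem delta''_eq_zero_iff {p q : ℕ} (c : Cochain G (Form n M q) p) :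
    delta'' n G M p q c = 0 ↔ ∀ g, c g ∈ closedForms n M q := by
  rw [funext_iff]
  refine forall_congr' fun g => ?_
  rw [delta''_apply, closedForms, LinearMap.mem_ker]
  simp

theorem delta''_delta'' {p q : ℕ} (c : Cochain G (Form n M q) p) :
    delta'' n G M p (q + 1) (delta'' n G M p q c) = 0 := by
  funext g
  simp [delta''_apply, d_d]

theorem d_delta' {p q : ℕ} (c : Cochain G (Form n M q) p) (g : Fin (p + 1) → G) :
    d n M q (delta' n G M p q c g) = delta' n G M p (q + 1) (fun h => d n M q (c h)) g :=
  coboundary_map _ _ (d n M q) (d_formRep n G M q) c g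

/-- Pull back commutes with `d`, hence so does `D`; the sign `(-1)^p` in `δ''` turns this into
anticommutation. -/
theorem delta'_delta'' {p q : ℕ} (c : Cochain G (Form n M q) p) :
    delta' n G M p (q + 1) (delta'' n G M p q c) + delta'' n G M (p + 1) q (delta' n G M p q c) =
      0 := by
  have h : delta'' n G M p q c = (-1 : ℝ) ^ p • fun h => d n M q (c h) := rfl
  funext g
  rw [h, map_smul, Pi.add_apply, delta''_apply, d_delta', pow_succ]
  simp

theorem deltaH_deltaH (c : DoubleCochain n G M) : deltaH (deltaH c) = 0 := by
  funext p q
  rcases p with _ | _ | p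
  · rfl
  · exact map_zero _
  · exact delta'_delta' (c p q)

theorem deltaV_deltaV (c : DoubleCochain n G M) : deltaV (deltaV c) = 0 := by
  funext p q
  rcases q with _ | _ | q
  · rfl
  · exact map_zero _
  · exact delta''_delta'' (c p q)

theorem deltaH_deltaV (c : DoubleCochain n G M) : deltaH (deltaV c) + deltaV (deltaH c) = 0 := by
  funext p q
  rcases p with _ | p <;> rcases q with _ | q
  · exact add_zero _
  · exact (congrArg₂ _ rfl (map_zero (delta'' n G M 0 q))).trans (add_zero _)
  · exact (congrArg₂ _ (map_zero (delta' n G M p 0)) rfl).trans (add_zero _)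
  · exact delta'_delta'' (c p q)

theorem totalDelta_apply (c : DoubleCochain n G M) : totalDelta n G M c = deltaH c + deltaV c := rfl

/-- `δ ∘ δ = 0`. -/
theorem totalDelta_totalDelta (c : DoubleCochain n G M) :
    totalDelta n G M (totalDelta n G M c) = 0 := by
  have hH : deltaH (deltaH c + deltaV c) = deltaH (deltaH c) + deltaH (deltaV c) := by
    funext p q
    cases p
    · exact (add_zero _).symm
    · exact map_add _ _ _
  have hV : deltaV (deltaH c + deltaV c) = deltaV (deltaH c) + deltaV (deltaV c) := by
    funext p q
    cases q
    · exact (add_zero _).symm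
    · exact map_add _ _ _
  simp only [totalDelta_apply]
  rw [hH, hV, deltaH_deltaH, deltaV_deltaV, zero_add, add_zero, deltaH_deltaV]

/-- The hypothesis ranges over predecessors of `p` and is empty at `p = 0`, so the edge of the
double complex needs no separate treatment later. -/
theorem deltaH_eq_zero {c : DoubleCochain n G M} {p q : ℕ} (h : ∀ i, i + 1 = p → c i q = 0) :
    deltaH c p q = 0 := by
  cases p with
  | zero => rfl
  | succ p => exact (congrArg _ (h p rfl)).trans (map_zero _)

theorem deltaV_eq_zero {c : DoubleCochain n G M} {p q : ℕ} (h : ∀ j, j + 1 = q → c p j = 0) :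
    deltaV c p q = 0 := by
  cases q with
  | zero => rfl
  | succ q => exact (congrArg _ (h q rfl)).trans (map_zero _)

theorem totalDelta_mem_filtration {r N : ℕ} {c : DoubleCochain n G M}
    (hc : c ∈ filtration n G M r N) : totalDelta n G M c ∈ filtration n G M r (N + 1) := by
  intro p q h
  change deltaH c p q + deltaV c p q = 0
  rw [deltaH_eq_zero fun i hi => hc i q (by omega), deltaV_eq_zero fun j hj => hc p j (by omega),
    add_zero]

theorem exists_mem_filtration {r j : ℕ} (b : Cochain G (Form n M j) r) :
    ∃ χ ∈ filtration n G M r (r + j), χ r j = b := by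
  refine ⟨Pi.single r (Pi.single j b), fun i k h => ?_, by simp⟩
  by_cases hi : i = r
  · subst hi
    rw [Pi.single_eq_same, Pi.single_eq_of_ne (by omega)]
  · rw [Pi.single_eq_of_ne hi, Pi.zero_apply]

theorem formCochain_apply_self {m : ℕ} (α : Form n M m) :
    formCochain (G := G) α 0 m = fun _ => α := by
  simp [formCochain]

theorem formCochain_apply_of_ne {m p q : ℕ} (α : Form n M m) (h : p ≠ 0 ∨ q ≠ m) :
    formCochain (G := G) α p q = 0 := by
  by_cases hp : p = 0
  · subst hp
    simp [formCochain, Pi.single_eq_of_ne (show q ≠ m by simpa using h)]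
  · simp [formCochain, Pi.single_eq_of_ne hp]

theorem formCochain_mem_filtration {m : ℕ} (α : Form n M m) :
    formCochain α ∈ filtration n G M 0 m :=
  fun _ _ h => formCochain_apply_of_ne α (by omega)

theorem formCochain_sub {m : ℕ} (α β : Form n M m) :
    formCochain (G := G) (α - β) = formCochain α - formCochain β := by
  funext p q
  by_cases h : p ≠ 0 ∨ q ≠ m
  · simp [formCochain_apply_of_ne _ h]
  · push Not at h
    obtain ⟨rfl, rfl⟩ := h
    simp only [Pi.sub_apply, formCochain_apply_self]
    rfl

theorem delta'_const {q : ℕ} {γ : Form n M q} (hγ : γ ∈ invariantForms n G M q) :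
    delta' n G M 0 q (fun _ => γ) = 0 := by
  funext g
  have h0 : (formRep n G M q) (MulOpposite.op (g 0)) γ = γ := hγ _
  simp [delta', coboundary, h0]

/-- Invariance kills the `δ'` part. Forms that are cohomologous in `Ω(M)^G` thus become cohomologous
in the total complex. -/
theorem totalDelta_formCochain {m : ℕ} (γ : Form n M m) (hγ : γ ∈ invariantForms n G M m) :
    totalDelta n G M (formCochain γ) = formCochain (d n M m γ) := by
  have hH : deltaH (formCochain (G := G) γ) = 0 := by
    funext p q
    by_cases h : p = 1 ∧ q = m
    · obtain ⟨rfl, rfl⟩ := h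
      change delta' n G M 0 q (formCochain γ 0 q) = 0
      rw [formCochain_apply_self]
      exact delta'_const hγ
    · exact deltaH_eq_zero fun i hi => formCochain_apply_of_ne γ (by omega)
  have hV : deltaV (formCochain (G := G) γ) = formCochain (d n M m γ) := by
    funext p q
    by_cases h : p ≠ 0 ∨ q ≠ m + 1
    · rw [formCochain_apply_of_ne _ h]
      exact deltaV_eq_zero fun j hj => formCochain_apply_of_ne γ (by omega)
    · push Not at h
      obtain ⟨rfl, rfl⟩ := h
      change delta'' n G M 0 m (formCochain γ 0 m) = _
      rw [formCochain_apply_self, formCochain_apply_self]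
      funext g
      simp [delta''_apply]
  rw [totalDelta_apply, hH, hV, zero_add]

/-! ### Cochains which represent cohomology classes -/

variable (n G M) in
/-- The right action of `G` on closed forms. -/
def closedRep (q : ℕ) : Representation ℝ Gᵐᵒᵖ (closedForms n M q) where
  toFun g := (formRep n G M q g).restrict (formRep_mem_closedForms n G M q g)
  map_one' := LinearMap.ext fun α =>
    Subtype.ext (LinearMap.congr_fun (map_one (formRep n G M q)) α.1)
  map_mul' g g' := LinearMap.ext fun α =>
    Subtype.ext (LinearMap.congr_fun (map_mul (formRep n G M q) g g') α.1)

variable (n M) in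
/-- The class of a closed form. -/
def deRhamClass (q : ℕ) : closedForms n M q →ₗ[ℝ] DeRhamCohomology n M q :=
  ((exactForms n M q).submoduleOf (closedForms n M q)).mkQ

theorem deRhamClass_eq_zero_iff {q : ℕ} (α : closedForms n M q) :
    deRhamClass n M q α = 0 ↔ α.1 ∈ exactForms n M q :=
  Submodule.Quotient.mk_eq_zero _

/-- Closed forms mediate between `Ω^q(M)` and `H^q(M)`: the inclusion and the projection are both
equivariant, so `D` commutes with each. -/
theorem coe_coboundary_closedRep {k q : ℕ} (z : Cochain G (closedForms n M q) k)
    (g : Fin (k + 1) → G) :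
    (coboundary (closedRep n G M q) k z g : Form n M q) =
      delta' n G M k q (fun h => (z h : Form n M q)) g :=
  coboundary_map _ _ (closedForms n M q).subtype (fun _ _ => rfl) z g

theorem deRhamClass_coboundary {k q : ℕ} (z : Cochain G (closedForms n M q) k)
    (g : Fin (k + 1) → G) :
    deRhamClass n M q (coboundary (closedRep n G M q) k z g) =
      coboundary (deRhamRep n G M q) k (fun h => deRhamClass n M q (z h)) g :=
  coboundary_map _ _ (deRhamClass n M q) (fun _ _ => rfl) z g

theorem exists_represents {k q : ℕ} {z : Cochain G (Form n M q) k}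
    (hz : ∀ g, z g ∈ closedForms n M q) (hD : ∀ g, delta' n G M k q z g ∈ exactForms n M q) :
    ∃ c, Represents z c := by
  refine ⟨_, ⟨fun g => deRhamClass n M q ⟨z g, hz g⟩, ?_⟩, fun g => ⟨hz g, rfl⟩, rfl⟩
  refine funext fun g => ?_
  rw [← deRhamClass_coboundary fun h => ⟨z h, hz h⟩]
  refine (deRhamClass_eq_zero_iff _).2 ?_
  rw [coe_coboundary_closedRep]
  exact hD g

/-- The values of `z` determine the cocycle of classes. This gives the uniqueness of `c(ω)`. -/
theorem Represents.eq {k q : ℕ} {z : Cochain G (Form n M q) k}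
    {c c' : RightGroupCohomology (deRhamRep n G M q) k} (h : Represents z c)
    (h' : Represents z c') : c = c' := by
  obtain ⟨f, hf, rfl⟩ := h
  obtain ⟨f', hf', rfl⟩ := h'
  congr 1
  refine Subtype.ext (funext fun g => ?_)
  obtain ⟨hz, e⟩ := hf g
  obtain ⟨hz', e'⟩ := hf' g
  rw [e, e']

/-- Adding to a cochain the coboundary of a cochain with closed values and a cochain with exact
values does not change the class it represents. -/
theorem Represents.congr {k q : ℕ} {z z' : Cochain G (Form n M q) (k + 1)}
    {c : RightGroupCohomology (deRhamRep n G M q) (k + 1)} (h : Represents z c)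
    (b : Cochain G (Form n M q) k) (hb : ∀ g, b g ∈ closedForms n M q)
    (hz' : ∀ g, z' g - z g - delta' n G M k q b g ∈ exactForms n M q) : Represents z' c := by
  obtain ⟨f, hf, rfl⟩ := h
  let B : Cochain G (closedForms n M q) k := fun g => ⟨b g, hb g⟩
  let u : Cochain G (DeRhamCohomology n M q) k := fun g => deRhamClass n M q (B g)
  have hcl : ∀ g, z' g ∈ closedForms n M q := fun g => by
    have h1 := exactForms_le_closedForms n M q (hz' g)
    have h2 : delta' n G M k q b g ∈ closedForms n M q := by
      rw [← coe_coboundary_closedRep B]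
      exact Subtype.prop _
    have h3 := add_mem (add_mem h1 h2) (hf g).choose
    simpa using h3
  -- Exact values vanish in `H^q(M)`, so the new cocycle is the old one plus `D` of the classes of
  -- `b`.
  refine ⟨f + ⟨coboundary _ k u, coboundary_coboundary _ u⟩, fun g => ⟨hcl g, ?_⟩, ?_⟩
  · obtain ⟨hz, e⟩ := hf g
    change f.1 g + coboundary _ k u g = deRhamClass n M q _
    rw [e, ← deRhamClass_coboundary B]
    refine (sub_eq_zero.1 ?_).symm
    change deRhamClass n M q _ - (deRhamClass n M q _ + deRhamClass n M q _) = 0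
    rw [← map_add, ← map_sub, deRhamClass_eq_zero_iff]
    have h1 := hz' g
    rw [sub_sub] at h1
    rw [Submodule.coe_sub, Submodule.coe_add, coe_coboundary_closedRep]
    exact h1
  · refine (Submodule.Quotient.eq _).2 ?_
    rw [add_sub_cancel_left]
    exact ⟨u, rfl⟩

/-! ### Zig-zags and the filtration -/

theorem exists_delta''_eq {j : ℕ} (hj : Subsingleton (DeRhamCohomology n M (j + 1))) {k : ℕ}
    (c : Cochain G (Form n M (j + 1)) k) (hc : delta'' n G M k (j + 1) c = 0) :
    ∃ b, delta'' n G M k j b = c := by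
  rw [delta''_eq_zero_iff] at hc
  have h : ∀ g, ∃ β, d n M j β = c g := fun g =>
    (deRhamClass_eq_zero_iff ⟨c g, hc g⟩).1 (Subsingleton.elim _ _)
  choose b hb using h
  -- The factor cancels the sign in `δ''`, as `(-1)^k` squares to `1`.
  refine ⟨(-1 : ℝ) ^ k • b, funext fun g => ?_⟩
  rw [map_smul, Pi.smul_apply, delta''_apply, hb, smul_smul, ← mul_pow]
  simp

/-- Each `-δ'φ_{r,j+1}` is `δ''`-closed, and `H^{j+1}(M) = 0` supplies `φ_{r+1,j}`. The degrees `j +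
1 = p + q - r` with `r < p` are exactly those assumed to vanish. -/
theorem exists_isZigZag {p q : ℕ} (α : Form n M (p + q + 1))
    (hinv : α ∈ invariantForms n G M (p + q + 1)) (hex : α ∈ exactForms n M (p + q + 1))
    (hvan : ∀ j : ℕ, q + 1 ≤ j → j ≤ q + p → Subsingleton (DeRhamCohomology n M j)) :
    ∃ φ : DoubleCochain n G M, IsZigZag α φ := by
  suffices h : ∀ r ≤ p, ∃ φ : DoubleCochain n G M, α = -d n M (p + q) (φ 0 (p + q) Fin.elim0) ∧
      ∀ i j : ℕ, i + 1 ≤ r → (i + 1) + j = p + q →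
        delta' n G M i (j + 1) (φ i (j + 1)) + delta'' n G M (i + 1) j (φ (i + 1) j) = 0 by
    obtain ⟨φ, h1, h2⟩ := h p le_rfl
    exact ⟨φ, h1, h2⟩
  intro r
  induction r with
  | zero =>
    intro _
    obtain ⟨β, rfl⟩ := hex
    refine ⟨formCochain (-β), ?_, fun i j hi => by omega⟩
    rw [formCochain_apply_self, map_neg, neg_neg]
  | succ r ih =>
    intro hr
    obtain ⟨φ, h1, h2⟩ := ih (by omega)
    obtain ⟨j, hj⟩ : ∃ j, r + 1 + j = p + q := ⟨p + q - (r + 1), by omega⟩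
    have hcl : delta'' n G M (r + 1) (j + 1) (-delta' n G M r (j + 1) (φ r (j + 1))) = 0 := by
      have e := delta'_delta'' (φ r (j + 1))
      rw [map_neg, neg_eq_zero]
      refine (eq_neg_of_add_eq_zero_right e).trans (neg_eq_zero.2 ?_)
      -- It remains to see `δ'δ''φ_r = 0`. For `r = 0`, `δ''φ_0` is the constant `-α`, killed by
      -- invariance; later `δ''φ_r = -δ'φ_{r-1}` and `δ'δ' = 0` applies.
      cases r with
      | zero =>
        have h3 : delta'' n G M 0 (p + q) (φ 0 (p + q)) = fun _ => -α := by
          funext g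
          obtain rfl : g = Fin.elim0 := Subsingleton.elim _ _
          rw [delta''_apply, pow_zero, one_smul]
          exact (neg_eq_iff_eq_neg.2 h1).symm
        have h4 := delta'_const (neg_mem hinv)
        rw [← h3, show p + q = j + 1 by omega] at h4
        exact h4
      | succ r =>
        have e' := h2 r (j + 1) le_rfl (by omega)
        rw [eq_neg_of_add_eq_zero_right e', map_neg, delta'_delta', neg_zero]
    obtain ⟨b, hb⟩ := exists_delta''_eq (hvan (j + 1) (by omega) (by omega)) _ hcl
    refine ⟨Function.update φ (r + 1) (Function.update (φ (r + 1)) j b), ?_, fun i k hi hk => ?_⟩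
    · rw [Function.update_of_ne (by omega)]
      exact h1
    · rw [Function.update_of_ne (by omega)]
      by_cases hir : i = r
      · subst hir
        obtain rfl : k = j := by omega
        rw [Function.update_self, Function.update_self, hb, add_neg_cancel]
      · rw [Function.update_of_ne (by omega)]
        exact h2 i k (by omega) hk

theorem IsZigZag.exists_filtrationCocycle {p q : ℕ} {β : Form n M (p + q + 1)}
    (hinv : β ∈ invariantForms n G M (p + q + 1)) {φ : DoubleCochain n G M}
    (hφ : IsZigZag β φ) :
    ∃ z ∈ filtrationCocycles n G M (p + 1) (p + q + 1), z (p + 1) q = delta' n G M p q (φ p q) ∧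
      z - formCochain β ∈ filtrationCoboundaries n G M 0 (p + q + 1) := by
  -- `IsZigZag` does not constrain the other components of `φ`, so they are cut off to land in total
  -- degree `p + q`.
  let ψ : DoubleCochain n G M := fun i j => if i ≤ p ∧ i + j = p + q then φ i j else 0
  have hψ : ∀ i j, i ≤ p → i + j = p + q → ψ i j = φ i j := fun i j h h' => if_pos ⟨h, h'⟩
  have hψ' : ∀ i j, ¬(i ≤ p ∧ i + j = p + q) → ψ i j = 0 := fun i j h => if_neg h
  have hψF : ψ ∈ filtration n G M 0 (p + q) := fun i j h => hψ' i j (by omega)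
  have hβ : β ∈ closedForms n M (p + q + 1) := by
    rw [hφ.start]
    exact neg_mem (d_d n M _ _)
  have hδβ : totalDelta n G M (formCochain β) = 0 := (formCochain_mem β hβ hinv).2
  refine ⟨formCochain β + totalDelta n G M ψ, ⟨?_, ?_⟩, ?_, ?_⟩
  · intro i j h
    by_cases hij : i + j = p + q + 1
    · have hi : i ≤ p := by omega
      cases i with
      | zero =>
        obtain rfl : j = p + q + 1 := by omega
        change formCochain β 0 _ + (0 + delta'' n G M 0 (p + q) (ψ 0 (p + q))) = 0
        rw [hψ _ _ (by omega) (by omega), formCochain_apply_self]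
        funext g
        obtain rfl : g = Fin.elim0 := Subsingleton.elim _ _
        simp only [Pi.add_apply, delta''_apply, Pi.zero_apply, pow_zero, one_smul, zero_add]
        exact add_eq_zero_iff_eq_neg.2 hφ.start
      | succ i =>
        obtain ⟨k, rfl⟩ : ∃ k, j = k + 1 := ⟨j - 1, by omega⟩
        change formCochain β (i + 1) _ + (delta' n G M i (k + 1) (ψ i (k + 1)) +
          delta'' n G M (i + 1) k (ψ (i + 1) k)) = 0
        rw [formCochain_apply_of_ne _ (by omega), hψ _ _ (by omega) (by omega),
          hψ _ _ (by omega) (by omega), zero_add]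
        exact hφ.step i k hi (by omega)
    · exact (add_mem (formCochain_mem_filtration β) (totalDelta_mem_filtration hψF) :
        _ ∈ filtration n G M 0 (p + q + 1)) i j (Or.inr hij)
  · rw [SetLike.mem_coe, LinearMap.mem_ker, map_add, hδβ, totalDelta_totalDelta, add_zero]
  · change formCochain β (p + 1) q + (delta' n G M p q (ψ p q) + deltaV ψ (p + 1) q) = _
    rw [formCochain_apply_of_ne _ (by omega), deltaV_eq_zero fun j _ => hψ' _ _ (by omega),
      hψ _ _ le_rfl rfl, zero_add, add_zero]
  · rw [add_sub_cancel_left]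
    exact ⟨ψ, hψF, rfl⟩

/-- The lowest component of a cocycle of `F_r` represents a class. -/
theorem exists_represents_of_mem_filtrationCocycles {r q N : ℕ} (hN : r + q = N)
    {z : DoubleCochain n G M} (hz : z ∈ filtrationCocycles n G M r N) :
    ∃ c, Represents (z r q) c := by
  have hδ : ∀ i j, deltaH z i j + deltaV z i j = 0 := fun i j => congrFun (congrFun hz.2 i) j
  refine exists_represents ((delta''_eq_zero_iff _).1 ?_) fun g => ?_
  -- Column `r - 1` of `z` is zero, so the equation at `(r, q + 1)` gives closed values; the one at
  -- `(r + 1, q)` makes `δ'z_{r,q}` exact.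
  · have h := hδ r (q + 1)
    rw [deltaH_eq_zero fun i hi => hz.1 i _ (by omega), zero_add] at h
    exact h
  · have h : delta' n G M r q (z r q) g = -deltaV z (r + 1) q g :=
      congrFun (eq_neg_of_add_eq_zero_left (hδ (r + 1) q)) g
    rw [h]
    refine neg_mem ?_
    cases q with
    | zero => exact Submodule.zero_mem _
    | succ q => exact Submodule.smul_mem _ _ ⟨_, rfl⟩

/-- The entry of `ψ` in column `r` is `δ''`-closed, since `δψ` vanishes in that column and `ψ` has
nothing to its left. It equals `δ''b`, and subtracting `δ` of `b` clears the column while `δ ∘ δ =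
0` preserves `δψ`. -/
theorem exists_mem_filtration_succ {r N j : ℕ} (hN : r + (j + 1) = N)
    (hj : Subsingleton (DeRhamCohomology n M (j + 1))) {ψ : DoubleCochain n G M}
    (hψ : ψ ∈ filtration n G M r N)
    (hδ : totalDelta n G M ψ ∈ filtration n G M (r + 1) (N + 1)) :
    ∃ ψ' ∈ filtration n G M (r + 1) N, totalDelta n G M ψ' = totalDelta n G M ψ := by
  have h : deltaH ψ r (j + 2) + deltaV ψ r (j + 2) = 0 := hδ _ _ (by omega)
  rw [deltaH_eq_zero fun i hi => hψ i _ (by omega), zero_add] at h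
  obtain ⟨b, hb⟩ := exists_delta''_eq hj _ h
  obtain ⟨χ, hχ, rfl⟩ := exists_mem_filtration b
  refine ⟨ψ - totalDelta n G M χ, fun i k hik => ?_, ?_⟩
  · by_cases h1 : i = r ∧ k = j + 1
    · obtain ⟨rfl, rfl⟩ := h1
      change ψ i (j + 1) - (deltaH χ i (j + 1) + delta'' n G M i j (χ i j)) = 0
      rw [deltaH_eq_zero fun l hl => hχ l _ (by omega), hb, zero_add, sub_self]
    · have h2 := totalDelta_mem_filtration hχ
      rw [add_assoc, hN] at h2
      exact (sub_mem hψ h2 : _ ∈ filtration n G M r N) i k (by omega)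
  · rw [map_sub, totalDelta_totalDelta, sub_zero]

/-- If `H^{q+1}(M) = … = H^{q+p}(M) = 0`, a coboundary of degree `p + q + 1` which lies in
`F_{p+1}` is the coboundary of an element of `F_p`. -/
theorem exists_mem_filtration_totalDelta_eq {p q : ℕ}
    (hvan : ∀ j : ℕ, q + 1 ≤ j → j ≤ q + p → Subsingleton (DeRhamCohomology n M j))
    {ψ : DoubleCochain n G M} (hψ : ψ ∈ filtration n G M 0 (p + q))
    (hδ : totalDelta n G M ψ ∈ filtration n G M (p + 1) (p + q + 1)) :
    ∃ ψ' ∈ filtration n G M p (p + q), totalDelta n G M ψ' = totalDelta n G M ψ := by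
  suffices h : ∀ r ≤ p, ∃ ψ' ∈ filtration n G M r (p + q),
      totalDelta n G M ψ' = totalDelta n G M ψ from h p le_rfl
  intro r
  induction r with
  | zero => exact fun _ => ⟨ψ, hψ, rfl⟩
  | succ r ih =>
    intro hr
    obtain ⟨ψ', h1, h2⟩ := ih (by omega)
    -- Clearing column `r` uses `H^{p+q-r}(M) = 0`, available only for `r < p`. Column `p` would
    -- need `H^q(M) = 0`, so the process stops in `F_p`.
    obtain ⟨j, hj⟩ : ∃ j, r + (j + 1) = p + q := ⟨p + q - (r + 1), by omega⟩
    rw [← h2]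
    refine exists_mem_filtration_succ hj (hvan (j + 1) (by omega) (by omega)) h1 ?_
    rw [h2]
    exact fun i k hik => hδ i k (by omega)

/-- With the difference written as `δψ'`, `ψ'` in `F_p`, its component at `(p + 1, q)` is
`δ'ψ'_{p,q}` plus exact values. The component at `(p, q + 1)` vanishes, so `ψ'_{p,q}` has closed
values and `Represents.congr` applies. -/
theorem represents_of_sub_mem_filtrationCoboundaries {p q : ℕ}
    (hvan : ∀ j : ℕ, q + 1 ≤ j → j ≤ q + p → Subsingleton (DeRhamCohomology n M j))
    {z z' : DoubleCochain n G M} (hz : z ∈ filtration n G M (p + 1) (p + q + 1))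
    (hz' : z' ∈ filtration n G M (p + 1) (p + q + 1))
    (h : z' - z ∈ filtrationCoboundaries n G M 0 (p + q + 1))
    {c : RightGroupCohomology (deRhamRep n G M q) (p + 1)} (hc : Represents (z (p + 1) q) c) :
    Represents (z' (p + 1) q) c := by
  obtain ⟨ψ, hψ, e⟩ := h
  have hδ : totalDelta n G M ψ ∈ filtration n G M (p + 1) (p + q + 1) := by
    rw [e]
    exact sub_mem hz' hz
  obtain ⟨ψ', hψ', e'⟩ := exists_mem_filtration_totalDelta_eq hvan hψ hδ
  refine hc.congr (ψ' p q) ((delta''_eq_zero_iff _).1 ?_) fun g => ?_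
  · have h1 : deltaH ψ' p (q + 1) + deltaV ψ' p (q + 1) = 0 :=
      (congrFun (congrFun e' p) (q + 1)).trans (hδ _ _ (by omega))
    rw [deltaH_eq_zero fun i hi => hψ' i _ (by omega), zero_add] at h1
    exact h1
  · have h1 : delta' n G M p q (ψ' p q) g + deltaV ψ' (p + 1) q g =
        z' (p + 1) q g - z (p + 1) q g :=
      congrFun (congrFun (congrFun (e'.trans e) (p + 1)) q) g
    rw [← h1, add_sub_cancel_left]
    cases q with
    | zero => exact Submodule.zero_mem _
    | succ q => exact Submodule.smul_mem _ _ ⟨_, rfl⟩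

theorem hMap_mk_eq_hClass_iff {r m : ℕ} (α : Form n M m) (hcl : α ∈ closedForms n M m)
    (hinv : α ∈ invariantForms n G M m) (z : filtrationCocycles n G M r m) :
    hMap n G M r m (Submodule.Quotient.mk z) = hClass α hcl hinv ↔
      z.1 - formCochain α ∈ filtrationCoboundaries n G M 0 m :=
  Submodule.Quotient.eq _

end Double
end EquivariantForms

end

/-! ### The class `c(ω)`. -/

open EquivariantForms
theorem mainTheorem1 {n : ℕ} {M : Type*} [TopologicalSpace M]
    [ChartedSpace (EuclideanSpace ℝ (Fin n)) M] [IsManifold (𝓡 n) ∞ M]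
    {G : Type*} [Group G] [MulAction G M] [SmoothAction n G M]
    (p q : ℕ) (hp : 1 ≤ p)
    (α : Form n M (p + q + 1))
    (hinv : α ∈ invariantForms n G M (p + q + 1))
    (hex : α ∈ exactForms n M (p + q + 1))
    (hvan : ∀ j : ℕ, q + 1 ≤ j → j ≤ q + p → Subsingleton (DeRhamCohomology n M j))
    (hne : Nontrivial (DeRhamCohomology n M q)) :
    hClass α (exactForms_le_closedForms n M _ hex) hinv ∈
        LinearMap.range (hMap n G M (p + 1) (p + q + 1)) ∧
    (∃ φ : DoubleCochain n G M, IsZigZag α φ) ∧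
    ∃! c : RightGroupCohomology (deRhamRep n G M q) (p + 1),
      (∀ z : filtrationCocycles n G M (p + 1) (p + q + 1),
        hMap n G M (p + 1) (p + q + 1) (Submodule.Quotient.mk z) =
            hClass α (exactForms_le_closedForms n M _ hex) hinv →
          Represents (z.1 (p + 1) q) c) ∧
      (∀ β ∈ invariantForms n G M (p + q + 1),
        α - β ∈ (invariantForms n G M (p + q)).map (d n M (p + q)) →
        ∀ φ : DoubleCochain n G M, IsZigZag β φ →
          Represents (delta' n G M p q (φ p q)) c) := by
  obtain ⟨φ, hφ⟩ := exists_isZigZag α hinv hex hvan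
  obtain ⟨z, hz, -, hzα⟩ := hφ.exists_filtrationCocycle hinv
  have hzc : hMap n G M (p + 1) (p + q + 1) (Submodule.Quotient.mk ⟨z, hz⟩) =
      hClass α (exactForms_le_closedForms n M _ hex) hinv :=
    (hMap_mk_eq_hClass_iff _ _ _ _).2 hzα
  obtain ⟨c, hc⟩ := exists_represents_of_mem_filtrationCocycles (q := q) (by omega) hz
  -- Both characterizations of `c` reduce to this comparison with the one cocycle `z`.
  have key : ∀ y ∈ filtrationCocycles n G M (p + 1) (p + q + 1),
      y - formCochain α ∈ filtrationCoboundaries n G M 0 (p + q + 1) →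
      Represents (y (p + 1) q) c := fun y hy hyα => by
    refine represents_of_sub_mem_filtrationCoboundaries hvan hz.1 hy.1 ?_ hc
    have h := sub_mem hyα hzα
    rwa [sub_sub_sub_cancel_right] at h
  -- The cocycle `z` satisfies the premise of the first condition, which therefore already forces
  -- `c' = c`.
  refine ⟨⟨_, hzc⟩, ⟨φ, hφ⟩, c, ⟨fun y hy => key y.1 y.2 ((hMap_mk_eq_hClass_iff _ _ _ _).1 hy),
    ?_⟩, fun c' hc' => (hc'.1 ⟨z, hz⟩ hzc).eq hc⟩
  rintro β hβ ⟨γ, hγ, hαβ⟩ φ' hφ'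
  obtain ⟨y, hy, hyφ, hyβ⟩ := hφ'.exists_filtrationCocycle hβ
  rw [← hyφ]
  refine key y hy ?_
  have h : formCochain α - formCochain β ∈ filtrationCoboundaries n G M 0 (p + q + 1) :=
    ⟨formCochain γ, formCochain_mem_filtration γ, by
      rw [totalDelta_formCochain γ hγ, hαβ, formCochain_sub]⟩
  have h2 := sub_mem hyβ h
  rwa [sub_sub_sub_cancel_right] at h2
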